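/- **Theorem (Relative Satisfiability).** Let $T_1$ and $T_2$ be normal theories of the logic $\mathrm{CTT}_{\mathrm{uqe}}$ (Church's type theory with quotation, evaluation, undefinedness and several base types), and let $\Phi$ be a semantic morphism from $T_1$ to $T_2$. If there is a general model for $T_2$, then there is a general model for $T_1$. The notions used are the following. *Syntax.* Types are built from a denumerable set $\mathcal B$ of base types, among them $o$ (truth values) and $\epsilon$ (constructions), by $\alpha\to\beta$. There are denumerably many variables of each type. The constants are an arbitrary set of typed symbols containing the logical constants $=_{\alpha\to\alpha\to o}$, $\iota_{(\alpha\to o)\to\alpha}$ ($\alpha\neq o$), $\mathsf{is\text{-}var}_{\epsilon\to o}$, $\mathsf{is\text{-}var}^\alpha_{\epsilon\to o}$, $\mathsf{is\text{-}con}_{\epsilon\to o}$, $\mathsf{is\text{-}con}^\alpha_{\epsilon\to o}$, $\mathsf{app}$, $\mathsf{abs}$, $\mathsf{cond}$, $\mathsf{quo}$, $\mathsf{is\text{-}expr}^\alpha_{\epsilon\to o}$, $\sqsubset_{\epsilon\to\epsilon\to o}$, $\mathsf{is\text{-}free\text{-}in}_{\epsilon\to\epsilon\to o}$. Expressions are variables,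 constants, applications $F A$, abstractions $\lambda x_\alpha . B$, conditionals $(\mathsf{if}\ A_o\ B_\alpha\ C_\alpha)$, quotations $\ulcorner A\urcorner$ (of type $\epsilon$, for $A$ eval-free), and evaluations $[\![A_\epsilon]\!]_{B_\beta}$ (of type $\beta$); an expression is eval-free if it is built without evaluations. $\mathcal E$ maps each eval-free expression injectively to an expression of type $\epsilon$ representing its syntax tree ($\mathcal E(x)=\ulcorner x\urcorner$, $\mathcal E(c)=\ulcorner c\urcorner$, $\mathcal E(FA)=\mathsf{app}\,\mathcal E(F)\,\mathcal E(A)$, $\mathcal E(\lambda x.B)=\mathsf{abs}\,\mathcal E(x)\,\mathcal E(B)$, $\mathcal E(\mathsf{if}\,A\,B\,C)=\mathsf{cond}\,\mathcal E(A)\,\mathcal E(B)\,\mathcal E(C)$, $\mathcal E(\ulcorner A\urcorner)=\mathsf{quo}\,\mathcal E(A)$); the constructions are the values of $\mathcal E$. The connectives and quantifiers are defined from $=$ as usual, in particular $T_o$, $F_o$, $\forall$, $\wedge$, $\supset$, $\neg$; $A\simeq B$ is quasi-equality (both undefined, or both defined and equal); $\bot_o$ is $F_o$, and $\bot_\alpha$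 for $\alpha\ne o$ is the undefined expression $\iota(\lambda x_\alpha.\, x_\alpha\neq x_\alpha)$. *Semantics.* A general model $M$ consists of nonempty domains $D_\alpha$, with $D_o=\{\mathrm t,\mathrm f\}$, $D_\epsilon$ the set of constructions, $D_{\alpha\to o}$ a set of total functions $D_\alpha\to D_o$, and, for $\beta\ne o$, $D_{\alpha\to\beta}$ a set of partial or total functions from $D_\alpha$ to $D_\beta$; an interpretation $I(c_\alpha)\in D_\alpha$ of all constants in which the logical constants have their intended meaning ($=$ is identity, $\iota$ is partial definite description, the remaining ones are the indicated syntactic operations and predicates on constructions, where $\mathsf{app},\mathsf{abs},\mathsf{cond}$ are undefined when the result is not a construction); and a partial valuation $V_\varphi(A_\alpha)\in D_\alpha$, for all assignments $\varphi$ and all expressions, such that: $V_\varphi(x)=\varphi(x)$; $V_\varphi(c)=I(c)$; an application has the value of the function at the argument if everything is defined, and otherwise is $\mathrm f$ at type $o$ and undefined at other types; $V_\varphi(\lambda x_\alpha.B_\beta)$ is the function in $D_{\alpha\to\beta}$ with $d\mapsto V_{\varphi[x\mapsto d]}(B)$; conditionals are non-strict in the branch that is not selected; $V_\varphi(\ulcorner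 A\urcorner)=\mathcal E(A)$; $V_\varphi([\![A]\!]_{B_\beta})=V_\varphi(C)$ if $V_\varphi(A)=\mathcal E(C)$ for some eval-free $C$ of type $\beta$, and otherwise it is $\mathrm f$ if $\beta=o$ and undefined if $\beta\ne o$. $M\vDash A_o$ means $V_\varphi(A_o)=\mathrm t$ for all $\varphi$. An expression $B$ is semantically closed if $\forall y_\alpha.((\lambda x_\alpha.B)\,y_\alpha=B)$ holds in every general model for all distinct variables $x_\alpha,y_\alpha$. *Theories.* A language is the set $L$ of all expressions whose base types and constants belong to given sets $\mathcal B'\ni o,\epsilon$ and $\mathcal C'\supseteq\{\text{logical constants}\}$. (The base types in the superscript of a constant count as occurring in it.) A theory $T=(L,\Gamma)$ is a language with a set $\Gamma$ of formulas (expressions of type $o$) of $L$; it is normal if all members of $\Gamma$ are semantically closed. A general model for $T$ is a general model $M$ with $M\vDash A$ for all $A\in\Gamma$, and $T\vDash A$ means that $M\vDash A$ for every general model $M$ for $T$. *Morphisms.* A translation from $T_1$ to $T_2$ is a pair $\Phi=(\mu,\nu)$. Here $\mu$ maps each base type $\alpha$ of $L_1$ to a semantically closed eval-free predicate of $L_2$,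 i.e. an expression of some type $\tau(\mu(\alpha))\to o$, with $\mu(o)=\lambda x_o.T_o$ and $\mu(\epsilon)=\lambda x_\epsilon.T_o$. It is extended to all types of $L_1$ by $\bar\mu(\alpha\to\beta)=\bar\mu(\alpha)\rightharpoonup\bar\mu(\beta)$, where for $p$ of type $\gamma\to o$ and $q$ of type $\delta\to o$ $$p\rightharpoonup q\ :=\ \lambda f_{\gamma\to\delta}.\,\forall x_\gamma.\,\bigl(\neg(f\,x\simeq\bot_\delta)\supset(p\,x\wedge q\,(f\,x))\bigr).$$ And $\nu$ is an injective map from the variables and constants of $L_1$ to those of $L_2$ that sends a variable (constant) of type $\alpha$ to a variable (constant) of type $\tau(\bar\mu(\alpha))$. It is extended to $\bar\nu:L_1\to L_2$ by commuting with application, conditional, quotation and evaluation, and by $$\bar\nu(\lambda x_\alpha.B_\beta)=\lambda\,\nu(x_\alpha).\,(\mathsf{if}\ (\bar\mu(\alpha)\,\nu(x_\alpha))\ \bar\nu(B_\beta)\ \bot_{\tau(\bar\mu(\beta))}).$$ $\Phi$ is a semantic morphism if $T_1\vDash A$ implies $T_2\vDash\bar\nu(A)$ for all semantically closed formulas $A$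 of $L_1$. -/

import Mathlib

universe u

namespace CTT

/-! ### Types and constants -/

/-- Base types: the truth values `o`, the constructions `eps`, and denumerably many
base types of individuals. -/
inductive Base : Type
  | o : Base
  | eps : Base
  | ind : ℕ → Base
  deriving DecidableEq

/-- Types, built from base types by the function type `arr α β`, i.e. `α → β`. -/
inductive Ty : Type
  | base : Base → Ty
  | arr : Ty → Ty → Ty
  deriving DecidableEq

/-- The type of truth values. -/
abbrev Ty.o : Ty := .base .o

/-- The type of constructions. -/
abbrev Ty.eps : Ty := .base .eps

infixr:60 " ⇒ " => CTT.Ty.arr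

/-- Constants of each type: the logical constants, and the nonlogical constants, which are
an arbitrary family `K` of typed symbols.  A variable of type `α` will be a pair of `α` and a
natural number, so that variables and constants are disjoint and each type has denumerably
many variables. -/
inductive Con (K : Ty → Type u) : Ty → Type u
  | eq (α : Ty) : Con K (α ⇒ α ⇒ Ty.o)
  | iota (α : Ty) (h : α ≠ Ty.o) : Con K ((α ⇒ Ty.o) ⇒ α)
  | isVar : Con K (Ty.eps ⇒ Ty.o)
  | isVarTy (α : Ty) : Con K (Ty.eps ⇒ Ty.o)
  | isCon : Con K (Ty.eps ⇒ Ty.o)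
  | isConTy (α : Ty) : Con K (Ty.eps ⇒ Ty.o)
  | app : Con K (Ty.eps ⇒ Ty.eps ⇒ Ty.eps)
  | abs : Con K (Ty.eps ⇒ Ty.eps ⇒ Ty.eps)
  | cond : Con K (Ty.eps ⇒ Ty.eps ⇒ Ty.eps ⇒ Ty.eps)
  | quo : Con K (Ty.eps ⇒ Ty.eps)
  | isExprTy (α : Ty) : Con K (Ty.eps ⇒ Ty.o)
  | sub : Con K (Ty.eps ⇒ Ty.eps ⇒ Ty.o)
  | isFreeIn : Con K (Ty.eps ⇒ Ty.eps ⇒ Ty.o)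
  | nonlog {α : Ty} (k : K α) : Con K α

/-- The constant is a logical constant. -/
def Con.IsLogical {K : Ty → Type u} {α : Ty} : Con K α → Prop
  | .nonlog _ => False
  | _ => True

/-! ### Expressions -/

/-- Expressions of each type.  `Exp K true α` is the type of all expressions of type `α`,
and `Exp K false α` that of the eval-free ones (those built without `eval`).  Only eval-free
expressions can be quoted. -/
inductive Exp (K : Ty → Type u) : Bool → Ty → Type u
  | var {b : Bool} (α : Ty) (n : ℕ) : Exp K b α
  | con {b : Bool} {α : Ty} (c : Con K α) : Exp K b α
  | app {b : Bool} {α β : Ty} (F : Exp K b (α ⇒ β)) (A : Exp K b α) : Exp K b β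
  | lam {b : Bool} {β : Ty} (α : Ty) (n : ℕ) (B : Exp K b β) : Exp K b (α ⇒ β)
  | cond {b : Bool} {α : Ty} (A : Exp K b Ty.o) (B C : Exp K b α) : Exp K b α
  | quo {b : Bool} {α : Ty} (A : Exp K false α) : Exp K b Ty.eps
  | eval {b : Bool} {β : Ty} (hb : b = true) (A : Exp K b Ty.eps) (B : Exp K b β) : Exp K b β

namespace Exp

variable {K : Ty → Type u}

/-- An expression seen as an expression of a possibly larger class; in particular every
eval-free expression is an expression. -/
def weaken {b b' : Bool} (h : b = true → b' = true) {α : Ty} : Exp K b α → Exp K b' α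
  | .var α n => .var α n
  | .con c => .con c
  | .app F A => .app (weaken h F) (weaken h A)
  | .lam α n B => .lam α n (weaken h B)
  | .cond A B C => .cond (weaken h A) (weaken h B) (weaken h C)
  | .quo A => .quo A
  | .eval hb A B => .eval (h hb) (weaken h A) (weaken h B)

/-- The inclusion of the eval-free expressions. -/
def up {b : Bool} {α : Ty} (A : Exp K false α) : Exp K b α :=
  A.weaken (fun h => absurd h (by decide))

/-- `FreeIn α n A`: the variable of type `α` with index `n` has a free occurrence in `A`;
occurrences inside quotations are not free.  It is only used for eval-free `A`. -/
def FreeIn (α : Ty) (n : ℕ) {b : Bool} {β : Ty} : Exp K b β → Prop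
  | .var γ m => α = γ ∧ n = m
  | .con _ => False
  | .app F A => FreeIn α n F ∨ FreeIn α n A
  | .lam γ m B => ¬ (α = γ ∧ n = m) ∧ FreeIn α n B
  | .cond A B C => FreeIn α n A ∨ FreeIn α n B ∨ FreeIn α n C
  | .quo _ => False
  | .eval _ A B => FreeIn α n A ∨ FreeIn α n B

/-- `ProperSub A B`: the eval-free expression `A` is a proper subexpression of the eval-free
expression `B`. -/
inductive ProperSub : {α β : Ty} → Exp K false α → Exp K false β → Prop
  | appL {α β : Ty} (F : Exp K false (α ⇒ β)) (A : Exp K false α) : ProperSub F (.app F A)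
  | appR {α β : Ty} (F : Exp K false (α ⇒ β)) (A : Exp K false α) : ProperSub A (.app F A)
  | lamVar {β : Ty} (α : Ty) (n : ℕ) (B : Exp K false β) :
      ProperSub (.var α n) (.lam α n B)
  | lamBody {β : Ty} (α : Ty) (n : ℕ) (B : Exp K false β) : ProperSub B (.lam α n B)
  | condA {α : Ty} (A : Exp K false Ty.o) (B C : Exp K false α) : ProperSub A (.cond A B C)
  | condB {α : Ty} (A : Exp K false Ty.o) (B C : Exp K false α) : ProperSub B (.cond A B C)
  | condC {α : Ty} (A : Exp K false Ty.o) (B C : Exp K false α) : ProperSub C (.cond A B C)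
  | quo {α : Ty} (A : Exp K false α) : ProperSub A (.quo A)
  | trans {α β γ : Ty} {A : Exp K false α} {B : Exp K false β} {C : Exp K false γ} :
      ProperSub A B → ProperSub B C → ProperSub A C

/-! ### Constructions -/

/-- The function `ℰ` on eval-free expressions, here on expressions of a class `b` that is
known to be the eval-free one. -/
def encAux {b : Bool} (h : b = false) {α : Ty} : Exp K b α → Exp K false Ty.eps
  | .var α n => .quo (.var α n)
  | .con c => .quo (.con c)
  | .app F A => .app (.app (.con .app) (encAux h F)) (encAux h A)
  | .lam α n B => .app (.app (.con .abs) (.quo (.var α n))) (encAux h B)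
  | .cond A B C => .app (.app (.app (.con .cond) (encAux h A)) (encAux h B)) (encAux h C)
  | .quo A => .app (.con .quo) (encAux rfl A)
  | .eval hb _ _ => absurd (hb.symm.trans h) (by decide)

/-- The function `ℰ` that maps an eval-free expression to the expression of type `ε` that
represents its syntactic structure. -/
def enc {α : Ty} (A : Exp K false α) : Exp K false Ty.eps := encAux rfl A

/-- The expression is in the range of `ℰ`. -/
def IsConstruction (A : Exp K false Ty.eps) : Prop :=
  ∃ (α : Ty) (B : Exp K false α), B.enc = A

/-! ### Abbreviations -/

variable {b : Bool}

/-- `A = B` -/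
def eq {α : Ty} (A B : Exp K b α) : Exp K b Ty.o := .app (.app (.con (.eq α)) A) B

/-- `T_o` -/
def tru : Exp K b Ty.o := eq (.con (.eq Ty.o)) (.con (.eq Ty.o))

/-- `F_o` -/
def fls : Exp K b Ty.o := eq (.lam Ty.o 0 tru) (.lam Ty.o 0 (.var Ty.o 0))

/-- `∀ x . A` where `x` is the variable of type `α` with index `n` -/
def all (α : Ty) (n : ℕ) (A : Exp K b Ty.o) : Exp K b Ty.o := eq (.lam α n tru) (.lam α n A)

/-- `A ∧ B` -/
def and (A B : Exp K b Ty.o) : Exp K b Ty.o :=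
  .app (.app (.lam Ty.o 0 (.lam Ty.o 1
    (eq (.lam (Ty.o ⇒ Ty.o ⇒ Ty.o) 3
          (.app (.app (.var (Ty.o ⇒ Ty.o ⇒ Ty.o) 3) tru) tru))
        (.lam (Ty.o ⇒ Ty.o ⇒ Ty.o) 3
          (.app (.app (.var (Ty.o ⇒ Ty.o ⇒ Ty.o) 3) (.var Ty.o 0)) (.var Ty.o 1)))))) A) B

/-- `A ⊃ B` -/
def imp (A B : Exp K b Ty.o) : Exp K b Ty.o :=
  .app (.app (.lam Ty.o 0 (.lam Ty.o 1
    (eq (.var Ty.o 0) (and (.var Ty.o 0) (.var Ty.o 1))))) A) B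

/-- `¬ A` -/
def neg (A : Exp K b Ty.o) : Exp K b Ty.o := .app (.app (.con (.eq Ty.o)) fls) A

/-- `A ∨ B` -/
def or (A B : Exp K b Ty.o) : Exp K b Ty.o :=
  .app (.app (.lam Ty.o 0 (.lam Ty.o 1
    (neg (and (neg (.var Ty.o 0)) (neg (.var Ty.o 1)))))) A) B

/-- `A ↓`, i.e. `A` is defined -/
def isDef {α : Ty} (A : Exp K b α) : Exp K b Ty.o := eq A A

/-- `A ≃ B`, i.e. `A` and `B` are both undefined, or both defined and equal -/
def qeq {α : Ty} (A B : Exp K b α) : Exp K b Ty.o := imp (or (isDef A) (isDef B)) (eq A B)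

/-- `I x . x ≠ x`, an undefined expression of type `α ≠ o` -/
def undef (α : Ty) (h : α ≠ Ty.o) : Exp K b α :=
  .app (.con (.iota α h)) (.lam α 0 (neg (eq (.var α 0) (.var α 0))))

/-- `⊥_α`, which is `F_o` for `α = o` and a canonical undefined expression otherwise -/
def bot : (α : Ty) → Exp K b α
  | .base .o => fls
  | .base .eps => undef _ (by decide)
  | .base (.ind n) => undef _ (by simp)
  | .arr α β => undef _ (by simp)

/-- `p ⇀ q`, the predicate `λ f . ∀ x . (¬ (f x ≃ ⊥) ⊃ (p x ∧ q (f x)))`, which represents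
the functions from the values of `p` to the values of `q`: the total ones if the
values of `q` are truth values, and otherwise the partial and total ones. -/
def pfun {α β : Ty} (p : Exp K b (α ⇒ Ty.o)) (q : Exp K b (β ⇒ Ty.o)) :
    Exp K b ((α ⇒ β) ⇒ Ty.o) :=
  .lam (α ⇒ β) 2 (all α 0
    (imp (neg (qeq (.app (.var (α ⇒ β) 2) (.var α 0)) (bot β)))
      (and (.app p (.var α 0)) (.app q (.app (.var (α ⇒ β) 2) (.var α 0))))))

end Exp

/-- The constructions: the expressions in the range of `ℰ`. -/
def Construction (K : Ty → Type u) : Type u := {A : Exp K false Ty.eps // A.IsConstruction}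

namespace Construction

variable {K : Ty → Type u}

/-- The construction `ℰ(A)` of an eval-free expression. -/
def of {α : Ty} (A : Exp K false α) : Construction K := ⟨A.enc, α, A, rfl⟩

open Classical in
/-- The expression `A` as a construction, if it is one. -/
noncomputable def ofExp? (A : Exp K false Ty.eps) : Option (Construction K) :=
  if h : A.IsConstruction then some ⟨A, h⟩ else none

end Construction

/-! ### Frames, interpretations, general models -/

/-- The domain of each type, given the domains `ind n` of individuals and `fn α β` of
functions: the domain of `o` consists of the two truth values, and that of `ε` of the
constructions. -/
def Dom (K : Ty → Type u) (ind : ℕ → Type u) (fn : Ty → Ty → Type u) : Ty → Type u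
  | .base .o => ULift.{u} Bool
  | .base .eps => Construction K
  | .base (.ind n) => ind n
  | .arr α β => fn α β

/-- A frame.  The elements of `fn α β`, the domain of `α → β`, are partial functions: `ap f d`
is the value of `f` at `d`, with `none` for "undefined", and by `ap_injective` an element of
`fn α β` is nothing but the partial function it induces.  All domains are nonempty. -/
structure Frame (K : Ty → Type u) : Type (u + 1) where
  ind : ℕ → Type u
  fn : Ty → Ty → Type u
  ap : {α β : Ty} → fn α β → Dom K ind fn α → Option (Dom K ind fn β)
  ap_injective : ∀ α β : Ty, Function.Injective (ap (α := α) (β := β))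
  ap_total : ∀ (α : Ty) (f : fn α Ty.o) (d : Dom K ind fn α), (ap f d).isSome
  ind_nonempty : ∀ n, Nonempty (ind n)
  fn_nonempty : ∀ α β, Nonempty (fn α β)

namespace Frame

variable {K : Ty → Type u} (F : Frame K)

/-- The domain of the type `α`. -/
abbrev D (α : Ty) : Type u := Dom K F.ind F.fn α

open Classical in
/-- The truth value of a proposition. -/
noncomputable def tv (p : Prop) : F.D Ty.o := ULift.up (decide p)

/-- The value of a function at an argument. -/
def app₁ {α β : Ty} (f : F.D (α ⇒ β)) (d : F.D α) : Option (F.D β) := F.ap f d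

/-- `f(d)(e)`. -/
def app₂ {α β γ : Ty} (f : F.D (α ⇒ β ⇒ γ)) (d : F.D α) (e : F.D β) : Option (F.D γ) :=
  (F.app₁ f d).bind fun g => F.app₁ g e

/-- `f(d)(e)(e')`. -/
def app₃ {α β γ δ : Ty} (f : F.D (α ⇒ β ⇒ γ ⇒ δ)) (d : F.D α) (e : F.D β) (e' : F.D γ) :
    Option (F.D δ) :=
  (F.app₂ f d e).bind fun g => F.app₁ g e'

/-- The convention for failing expressions: an undefined value is replaced by the
truth value `f` at type `o`, and stays undefined at every other type. -/
noncomputable def orFalse : (β : Ty) → Option (F.D β) → Option (F.D β)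
  | .base .o, v => some (v.getD (F.tv False))
  | .base .eps, v => v
  | .base (.ind _), v => v
  | .arr _ _, v => v

/-- An assignment maps each variable (a type and an index) to an element of the domain of its
type. -/
def Assignment : Type u := (α : Ty) → ℕ → F.D α

/-- `φ[x ↦ d]` where `x` is the variable of type `α` with index `n`. -/
def Assignment.update {F : Frame K} (φ : F.Assignment) (α : Ty) (n : ℕ) (d : F.D α) :
    F.Assignment :=
  Function.update φ α (Function.update (φ α) n d)

end Frame

/-- An interpretation: a frame and an interpretation `I` of all constants in which the logical
constants have their prescribed values. -/
structure Interpretation (K : Ty → Type u) : Type (u + 1) extends Frame K where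
  I : {α : Ty} → Con K α → toFrame.D α
  eq_spec : ∀ (α : Ty) (d e : toFrame.D α),
    toFrame.app₂ (I (.eq α)) d e = some (toFrame.tv (d = e))
  iota_spec : ∀ (α : Ty) (h : α ≠ Ty.o) (p : toFrame.D (α ⇒ Ty.o)) (d : toFrame.D α),
    toFrame.app₁ (I (.iota α h)) p = some d ↔
      ∀ e : toFrame.D α, (toFrame.app₁ p e = some (toFrame.tv True) ↔ e = d)
  isVar_spec : ∀ A : Construction K, toFrame.app₁ (I .isVar) A =
    some (toFrame.tv (∃ (α : Ty) (n : ℕ), A.1 = .quo (.var α n)))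
  isVarTy_spec : ∀ (α : Ty) (A : Construction K), toFrame.app₁ (I (.isVarTy α)) A =
    some (toFrame.tv (∃ n : ℕ, A.1 = .quo (.var α n)))
  isCon_spec : ∀ A : Construction K, toFrame.app₁ (I .isCon) A =
    some (toFrame.tv (∃ (α : Ty) (c : Con K α), A.1 = .quo (.con c)))
  isConTy_spec : ∀ (α : Ty) (A : Construction K), toFrame.app₁ (I (.isConTy α)) A =
    some (toFrame.tv (∃ c : Con K α, A.1 = .quo (.con c)))
  app_spec : ∀ A B : Construction K, toFrame.app₂ (I .app) A B =
    Construction.ofExp? (.app (.app (.con .app) A.1) B.1)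
  abs_spec : ∀ A B : Construction K, toFrame.app₂ (I .abs) A B =
    Construction.ofExp? (.app (.app (.con .abs) A.1) B.1)
  cond_spec : ∀ A B C : Construction K, toFrame.app₃ (I .cond) A B C =
    Construction.ofExp? (.app (.app (.app (.con .cond) A.1) B.1) C.1)
  quo_spec : ∀ A : Construction K, ∃ B : Construction K,
    B.1 = .app (.con .quo) A.1 ∧ toFrame.app₁ (I .quo) A = some B
  isExprTy_spec : ∀ (α : Ty) (A : Construction K), toFrame.app₁ (I (.isExprTy α)) A =
    some (toFrame.tv (∃ B : Exp K false α, A.1 = B.enc))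
  sub_spec : ∀ A B : Construction K, toFrame.app₂ (I .sub) A B =
    some (toFrame.tv (Exp.ProperSub A.1 B.1))
  isFreeIn_spec : ∀ A B : Construction K, toFrame.app₂ (I .isFreeIn) A B =
    some (toFrame.tv (∃ (α : Ty) (n : ℕ) (β : Ty) (C : Exp K false β),
      A.1 = .quo (.var α n) ∧ B.1 = C.enc ∧ C.FreeIn α n))

/-- A general model: an interpretation for which there is a partial valuation function
`V` (`none` means "undefined") that satisfies the seven semantic clauses.  `V` is uniquely
determined by the interpretation. -/
structure GeneralModel (K : Ty → Type u) : Type (u + 1) extends Interpretation K where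
  V : toFrame.Assignment → {α : Ty} → Exp K true α → Option (toFrame.D α)
  V_var : ∀ (φ : toFrame.Assignment) (α : Ty) (n : ℕ), V φ (.var α n) = some (φ α n)
  V_con : ∀ (φ : toFrame.Assignment) (α : Ty) (c : Con K α), V φ (.con c) = some (I c)
  V_app : ∀ (φ : toFrame.Assignment) (α β : Ty) (F : Exp K true (α ⇒ β)) (A : Exp K true α),
    V φ (.app F A) =
      toFrame.orFalse β ((V φ F).bind fun f => (V φ A).bind fun d => toFrame.app₁ f d)
  V_lam : ∀ (φ : toFrame.Assignment) (α β : Ty) (n : ℕ) (B : Exp K true β),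
    ∃ f : toFrame.D (α ⇒ β), V φ (.lam α n B) = some f ∧
      ∀ d : toFrame.D α, toFrame.app₁ f d = V (φ.update α n d) B
  V_cond_true : ∀ (φ : toFrame.Assignment) (α : Ty) (A : Exp K true Ty.o) (B C : Exp K true α),
    V φ A = some (toFrame.tv True) → V φ (.cond A B C) = V φ B
  V_cond_false : ∀ (φ : toFrame.Assignment) (α : Ty) (A : Exp K true Ty.o) (B C : Exp K true α),
    V φ A = some (toFrame.tv False) → V φ (.cond A B C) = V φ C
  V_cond_undef : ∀ (φ : toFrame.Assignment) (α : Ty) (A : Exp K true Ty.o) (B C : Exp K true α),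
    V φ A = none → V φ (.cond A B C) = none
  V_quo : ∀ (φ : toFrame.Assignment) (α : Ty) (A : Exp K false α),
    V φ (.quo A) = some (Construction.of A)
  V_eval : ∀ (φ : toFrame.Assignment) (β : Ty) (A : Exp K true Ty.eps) (C : Exp K true β),
    V φ (.app (.con (.isExprTy β)) A) = some (toFrame.tv True) →
      ∀ B : Exp K false β, V φ A = some (Construction.of B) →
        V φ (.eval rfl A C) = V φ B.up
  V_eval_fail : ∀ (φ : toFrame.Assignment) (β : Ty) (A : Exp K true Ty.eps) (C : Exp K true β),
    V φ (.app (.con (.isExprTy β)) A) ≠ some (toFrame.tv True) →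
      V φ (.eval rfl A C) = toFrame.orFalse β none

/-- `M ⊨ A`: the formula `A` has the value "true" under every assignment. -/
def GeneralModel.Sat {K : Ty → Type u} (M : GeneralModel K) (A : Exp K true Ty.o) : Prop :=
  ∀ φ : M.toFrame.Assignment, M.V φ A = some (M.toFrame.tv True)

/-- `B` is semantically closed: `∀ y . ((λ x . B) y = B)` is valid in every general model for
all distinct variables `x` and `y` of the same type. -/
def SemClosed {K : Ty → Type u} {β : Ty} (B : Exp K true β) : Prop :=
  ∀ (α : Ty) (m n : ℕ), m ≠ n → ∀ M : GeneralModel K,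
    M.Sat (Exp.all α n (Exp.eq (.app (.lam α m B) (.var α n)) B))

/-! ### Languages and theories -/

/-- A language is given by a set of base types that contains the logical ones and a set of
constants that contains the logical ones; its expressions are those of `Language.Mem`. -/
structure Language (K : Ty → Type u) : Type u where
  bases : Set Base
  o_mem : Base.o ∈ bases
  eps_mem : Base.eps ∈ bases
  consts : (α : Ty) → Set (Con K α)
  logical_mem : ∀ (α : Ty) (c : Con K α), c.IsLogical → c ∈ consts α

namespace Language

variable {K : Ty → Type u} (L : Language K)

/-- Every base type that occurs in the type belongs to the language. -/
def HasTy : Ty → Prop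
  | .base a => a ∈ L.bases
  | .arr α β => HasTy α ∧ HasTy β

/-- Every base type that occurs in the superscript (if any) of the constant belongs to the
language. -/
def HasSup {α : Ty} : Con K α → Prop
  | .isVarTy γ => L.HasTy γ
  | .isConTy γ => L.HasTy γ
  | .isExprTy γ => L.HasTy γ
  | _ => True

/-- The constant is an expression of the language: it is one of the constants of the language
and every base type that occurs in it belongs to the language. -/
def HasCon {α : Ty} (c : Con K α) : Prop := c ∈ L.consts α ∧ L.HasTy α ∧ L.HasSup c

/-- The expression belongs to the language: every base type and every constant that occurs in
it belongs to the language. -/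
def Mem {b : Bool} {α : Ty} : Exp K b α → Prop
  | .var α _ => L.HasTy α
  | .con c => L.HasCon c
  | .app F A => Mem F ∧ Mem A
  | .lam α _ B => L.HasTy α ∧ Mem B
  | .cond A B C => Mem A ∧ Mem B ∧ Mem C
  | .quo A => Mem A
  | .eval _ A B => Mem A ∧ Mem B

end Language

/-- A theory: a language and a set of formulas of the language, the axioms. -/
structure Theory (K : Ty → Type u) : Type u where
  lang : Language K
  axs : Set (Exp K true Ty.o)
  axs_mem : ∀ A ∈ axs, lang.Mem A

namespace Theory

variable {K : Ty → Type u}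

/-- `M` is a general model for the theory `T`. -/
def IsModel (T : Theory K) (M : GeneralModel K) : Prop := ∀ A ∈ T.axs, M.Sat A

/-- `T ⊨ A`. -/
def Valid (T : Theory K) (A : Exp K true Ty.o) : Prop :=
  ∀ M : GeneralModel K, T.IsModel M → M.Sat A

/-- A theory is normal if all its axioms are semantically closed. -/
def Normal (T : Theory K) : Prop := ∀ A ∈ T.axs, SemClosed A

end Theory

/-! ### Translations -/

/-- An eval-free predicate `exp`, of type `ty → o`. -/
structure Pred (K : Ty → Type u) : Type u where
  ty : Ty
  exp : Exp K false (ty ⇒ Ty.o)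

/-- The predicate `λ x . T_o` on the type `α`. -/
def Pred.univ {K : Ty → Type u} (α : Ty) : Pred K := ⟨α, .lam α 0 Exp.tru⟩

/-- The predicate assigned to a base type, given the predicates `μ n` assigned to the base
types of individuals; `o` and `ε` are interpreted by `λ x . T_o`. -/
def muBase {K : Ty → Type u} (μ : ℕ → Pred K) : Base → Pred K
  | .o => Pred.univ Ty.o
  | .eps => Pred.univ Ty.eps
  | .ind n => μ n

/-- The type `τ(μ̄(α))`. -/
def tauBar {K : Ty → Type u} (μ : ℕ → Pred K) : Ty → Ty
  | .base .o => Ty.o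
  | .base .eps => Ty.eps
  | .base (.ind n) => (μ n).ty
  | .arr α β => tauBar μ α ⇒ tauBar μ β

/-- The predicate `μ̄(α)`. -/
def muBar {K : Ty → Type u} (μ : ℕ → Pred K) : (α : Ty) → Exp K false (tauBar μ α ⇒ Ty.o)
  | .base .o => (muBase μ .o).exp
  | .base .eps => (muBase μ .eps).exp
  | .base (.ind n) => (muBase μ (.ind n)).exp
  | .arr α β => Exp.pfun (muBar μ α) (muBar μ β)

/-- A translation `(μ, ν)` from a language to a language.  The base types of individuals
of the first language are mapped by `mu` to semantically closed eval-free predicates in the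
second one, and `nuVar` and `nuCon` are the restrictions of the injective function `ν` to
variables and constants: the variable of type `α` with index `n` is mapped to the variable of
type `τ(μ̄(α))` with index `nuVar α n`.  The values of `mu` and `nuVar` at base types and types
outside the first language play no role. -/
structure Translation {K : Ty → Type u} (L₁ L₂ : Language K) : Type u where
  mu : ℕ → Pred K
  mu_mem : ∀ n, Base.ind n ∈ L₁.bases → L₂.Mem (mu n).exp
  mu_closed : ∀ n, Base.ind n ∈ L₁.bases → SemClosed ((mu n).exp.up : Exp K true _)
  nuVar : Ty → ℕ → ℕ
  nuCon : {α : Ty} → (c : Con K α) → L₁.HasCon c → Con K (tauBar mu α)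
  nuCon_mem : ∀ {α : Ty} (c : Con K α) (h : L₁.HasCon c), L₂.HasCon (nuCon c h)
  nuVar_injective : ∀ (α β : Ty) (m n : ℕ), L₁.HasTy α → L₁.HasTy β →
    tauBar mu α = tauBar mu β → nuVar α m = nuVar β n → α = β ∧ m = n
  nuCon_injective : ∀ {α β : Ty} (c : Con K α) (d : Con K β) (hc : L₁.HasCon c)
    (hd : L₁.HasCon d), (⟨tauBar mu α, nuCon c hc⟩ : Σ γ : Ty, Con K γ) = ⟨tauBar mu β, nuCon d hd⟩ →
      (⟨α, c⟩ : Σ γ : Ty, Con K γ) = ⟨β, d⟩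

namespace Translation

variable {K : Ty → Type u} {L₁ L₂ : Language K} (Φ : Translation L₁ L₂)

/-- The extension `ν̄` of `ν` to the expressions of the first language.  It maps eval-free
expressions to eval-free ones. -/
def nuBar {b : Bool} {α : Ty} : (A : Exp K b α) → L₁.Mem A → Exp K b (tauBar Φ.mu α)
  | .var α n, _ => .var (tauBar Φ.mu α) (Φ.nuVar α n)
  | .con c, h => .con (Φ.nuCon c h)
  | .app F A, h => .app (nuBar F h.1) (nuBar A h.2)
  | .lam (β := β) α n B, h =>
      .lam (tauBar Φ.mu α) (Φ.nuVar α n)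
        (.cond (.app (muBar Φ.mu α).up (.var (tauBar Φ.mu α) (Φ.nuVar α n)))
          (nuBar B h.2) (Exp.bot (tauBar Φ.mu β)))
  | .cond A B C, h => .cond (nuBar A h.1) (nuBar B h.2.1) (nuBar C h.2.2)
  | .quo A, h => .quo (nuBar A h)
  | .eval hb A B, h => .eval hb (nuBar A h.1) (nuBar B h.2)

end Translation

/-- The translation `Φ` is a semantic morphism from `T₁` to `T₂`: it maps the semantically
closed formulas that are valid in `T₁` to formulas that are valid in `T₂`. -/
def IsSemanticMorphism {K : Ty → Type u} (T₁ T₂ : Theory K)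
    (Φ : Translation T₁.lang T₂.lang) : Prop :=
  ∀ (A : Exp K true Ty.o) (hA : T₁.lang.Mem A), SemClosed A → T₁.Valid A →
    T₂.Valid (Φ.nuBar A hA)

end CTT

/-!
If `T₁` has no general model, then every formula is valid in `T₁`, so a semantic morphism
forces the translation of every semantically closed formula of `T₁` to be valid in `T₂`.  It
remains to find a semantically closed formula of `T₁` whose translation is false in every
general model.

The formula `F_o` cannot serve directly: it is built from equality, and a translation may
send equality to any constant of the appropriate type.  But translations commute with
quotation and evaluation and preserve the types `o` and `ε`.  The formula used is therefore the
evaluation `⟦⌜x_ε⌝⟧` at type `o`: the quoted variable has type `ε`, not `o`, so the evaluation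
fails, and a failing formula is false (`GeneralModel.V_falsum`).  Its translation is an
evaluation of the same kind, of a possibly different variable of type `ε`, and is false as well.
A formula that is false in every general model under every assignment is semantically closed
(`semClosed_of_forall_V_eq`).
-/

namespace CTT

variable {K : Ty → Type u}

/-- The evaluation at type `o` of the quotation of the variable of type `ε` with index `n`.  The
second argument of `Exp.eval` serves only to indicate the type; it is the variable of type `o`
with index `m`. -/
def Exp.falsum (n m : ℕ) : Exp K true Ty.o :=
  .eval rfl (.quo (.var Ty.eps n)) (.var Ty.o m)

theorem Exp.enc_ne_quo_var {α β : Ty} (h : α ≠ β) (n : ℕ) (B : Exp K false β) :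
    B.enc ≠ .quo (.var α n) := by
  intro hB
  cases B with
  | var =>
    cases hB
    exact h rfl
  | eval hb => cases hb
  | _ => cases hB

namespace Frame

variable (F : Frame K)

theorem tv_injective {p q : Prop} (h : F.tv p = F.tv q) : p ↔ q := by
  exact decide_eq_decide.1 (congrArg ULift.down h)

theorem orFalse_some (β : Ty) (v : F.D β) : F.orFalse β (some v) = some v := by
  match β with
  | .base .o => rfl
  | .base .eps => rfl
  | .base (.ind _) => rfl
  | .arr _ _ => rfl

theorem tv_of_true {p : Prop} (h : p) : F.tv p = F.tv True := by
  rw [eq_true h]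

end Frame

namespace GeneralModel

variable (M : GeneralModel K) (φ : M.toFrame.Assignment)

theorem V_app_of_eq_some {α β : Ty} {F : Exp K true (α ⇒ β)} {A : Exp K true α}
    {f : M.toFrame.D (α ⇒ β)} {d : M.toFrame.D α} {v : M.toFrame.D β}
    (hF : M.V φ F = some f) (hA : M.V φ A = some d) (hv : M.toFrame.app₁ f d = some v) :
    M.V φ (.app F A) = some v := by
  rw [M.V_app, hF, hA, Option.bind_some, Option.bind_some, hv, Frame.orFalse_some]

theorem V_eq_of_eq_some {α : Ty} {A B : Exp K true α} {d e : M.toFrame.D α}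
    (hA : M.V φ A = some d) (hB : M.V φ B = some e) :
    M.V φ (Exp.eq A B) = some (M.toFrame.tv (d = e)) := by
  obtain ⟨g, hg, hge⟩ := Option.bind_eq_some_iff.1 (M.eq_spec α d e)
  exact M.V_app_of_eq_some φ (M.V_app_of_eq_some φ (M.V_con φ _ _) hA hg) hB hge

theorem V_tru : M.V φ Exp.tru = some (M.toFrame.tv True) :=
  (M.V_eq_of_eq_some φ (M.V_con φ _ _) (M.V_con φ _ _)).trans
    (congrArg some (M.toFrame.tv_of_true rfl))

theorem V_lam_congr {α β : Ty} {m n : ℕ} {A B : Exp K true β}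
    (h : ∀ d : M.toFrame.D α, M.V (φ.update α m d) A = M.V (φ.update α n d) B) :
    M.V φ (.lam α m A) = M.V φ (.lam α n B) := by
  obtain ⟨f, hf, hfd⟩ := M.V_lam φ α β m A
  obtain ⟨g, hg, hgd⟩ := M.V_lam φ α β n B
  rw [hf, hg]
  exact congrArg some (M.ap_injective α β (funext fun d => (hfd d).trans ((h d).trans (hgd d).symm)))

theorem V_all_of_forall {α : Ty} {n : ℕ} {A : Exp K true Ty.o}
    (h : ∀ d : M.toFrame.D α, M.V (φ.update α n d) A = some (M.toFrame.tv True)) :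
    M.V φ (Exp.all α n A) = some (M.toFrame.tv True) := by
  obtain ⟨f, hf, -⟩ := M.V_lam φ α Ty.o n A
  have htru : M.V φ (.lam α n Exp.tru) = some f :=
    (M.V_lam_congr φ fun d => (M.V_tru _).trans (h d).symm).trans hf
  exact (M.V_eq_of_eq_some φ htru hf).trans (congrArg some (M.toFrame.tv_of_true rfl))

/-- A quoted variable of type `ε` does not satisfy `is-expr^o`, so its evaluation at type `o`
fails. -/
theorem V_falsum (n m : ℕ) : M.V φ (Exp.falsum n m) = some (M.toFrame.tv False) := by
  refine M.V_eval_fail φ Ty.o _ _ ?_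
  rw [M.V_app_of_eq_some φ (M.V_con φ _ _) (M.V_quo φ _ _) (M.isExprTy_spec _ _)]
  intro h
  obtain ⟨B, hB⟩ := (M.toFrame.tv_injective (Option.some.inj h)).2 trivial
  exact Exp.enc_ne_quo_var (by decide) n B hB.symm

end GeneralModel

/-- An expression whose value in each general model is defined and does not depend on the
assignment is semantically closed. -/
theorem semClosed_of_forall_V_eq {β : Ty} {B : Exp K true β}
    (h : ∀ M : GeneralModel K, ∃ v, ∀ φ, M.V φ B = some v) : SemClosed B := by
  intro α m n _ M φ
  obtain ⟨v, hv⟩ := h M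
  refine M.V_all_of_forall φ fun d => ?_
  obtain ⟨f, hf, hfd⟩ := M.V_lam (φ.update α n d) α β m B
  have happ := M.V_app_of_eq_some _ hf (M.V_var _ α n) ((hfd _).trans (hv _))
  exact (M.V_eq_of_eq_some _ happ (hv _)).trans (congrArg some (M.toFrame.tv_of_true rfl))

theorem semClosed_falsum (n m : ℕ) : SemClosed (Exp.falsum n m : Exp K true Ty.o) :=
  semClosed_of_forall_V_eq fun M => ⟨_, fun φ => M.V_falsum φ n m⟩

end CTT

theorem mainTheorem2 {K : CTT.Ty → Type u} (T₁ T₂ : CTT.Theory K)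
    (h₁ : T₁.Normal) (h₂ : T₂.Normal) (Φ : CTT.Translation T₁.lang T₂.lang)
    (hΦ : CTT.IsSemanticMorphism T₁ T₂ Φ) :
    (∃ M₂ : CTT.GeneralModel K, T₂.IsModel M₂) → ∃ M₁ : CTT.GeneralModel K, T₁.IsModel M₁ := by
  rintro ⟨M₂, hM₂⟩
  by_contra hT₁
  have hmem : T₁.lang.Mem (CTT.Exp.falsum 0 0) := ⟨T₁.lang.eps_mem, T₁.lang.o_mem⟩
  have hsat : M₂.Sat (CTT.Exp.falsum (Φ.nuVar CTT.Ty.eps 0) (Φ.nuVar CTT.Ty.o 0)) :=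
    hΦ _ hmem (CTT.semClosed_falsum 0 0) (fun M₁ hM₁ => absurd ⟨M₁, hM₁⟩ hT₁) M₂ hM₂
  -- The domains are nonempty, so there is an assignment under which to evaluate.
  have hD : ∀ α, Nonempty (M₂.toFrame.D α)
    | .base .o => ⟨M₂.toFrame.tv True⟩
    | .base .eps => ⟨CTT.Construction.of (.var CTT.Ty.o 0)⟩
    | .base (.ind n) => M₂.ind_nonempty n
    | .arr α β => M₂.fn_nonempty α β
  let φ : M₂.toFrame.Assignment := fun α _ => (hD α).some
  exact (M₂.toFrame.tv_injective
    (Option.some.inj ((hsat φ).symm.trans (M₂.V_falsum φ _ _)))).1 trivial
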